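/- Let $(\mathfrak g,\cdot)$ be a complex (left) pre-Lie algebra, i.e. $(x\cdot y)\cdot z-x\cdot(y\cdot z)=(y\cdot x)\cdot z-y\cdot(x\cdot z)$, and put $[x,y]_{\mathfrak g}=x\cdot y-y\cdot x$. Let $(V;\mathcal L,\mathcal R)$ be a representation of $\mathfrak g$, i.e. a complex vector space $V$ with linear maps $\mathcal L,\mathcal R:\mathfrak g\to\mathfrak{gl}(V)$ such that $\mathcal L_x\mathcal L_y-\mathcal L_{x\cdot y}=\mathcal L_y\mathcal L_x-\mathcal L_{y\cdot x}$ and $\mathcal L_x\mathcal R_y-\mathcal R_y\mathcal L_x=\mathcal R_{x\cdot y}-\mathcal R_y\mathcal R_x$. Let $H:\mathfrak g\otimes\mathfrak g\to V$ be a $2$-cocycle, i.e. a bilinear map with $$\mathcal L_xH(y,z)-\mathcal L_yH(x,z)+\mathcal R_zH(y,x)-\mathcal R_zH(x,y)-H(y,x\cdot z)+H(x,y\cdot z)-H([x,y]_{\mathfrak g},z)=0 .$$ A linear map $K:V\to\mathfrak g$ is a *relative cocycle weighted (RCW) Reynolds operator* (with weight $H$) if $$Ku\cdot Kv=K\big(\mathcal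 L_{Ku}v+\mathcal R_{Kv}u+H(Ku,Kv)\big)\qquad(u,v\in V).$$ For a vector space $W$, $P\in\mathrm{Hom}(\wedge^{p}W\otimes W,W)$ and $Q\in\mathrm{Hom}(\wedge^{q}W\otimes W,W)$, let $[P,Q]^{MN}=P\diamond Q-(-1)^{pq}Q\diamond P$ be the Matsushima–Nijenhuis bracket, where $$\begin{aligned}(P\diamond Q)(x_1,\dots,x_{p+q+1})={}&\sum_{\sigma\in\mathbb S_{(q,1,p-1)}}\mathrm{sgn}(\sigma)\,P\big(Q(x_{\sigma(1)},\dots,x_{\sigma(q+1)}),x_{\sigma(q+2)},\dots,x_{\sigma(p+q)},x_{p+q+1}\big)\\&+(-1)^{pq}\sum_{\sigma\in\mathbb S_{(p,q)}}\mathrm{sgn}(\sigma)\,P\big(x_{\sigma(1)},\dots,x_{\sigma(p)},Q(x_{\sigma(p+1)},\dots,x_{\sigma(p+q)},x_{p+q+1})\big)\end{aligned}$$ (sums over unshuffles; the first sum is empty if $p=0$). Put $C^n=\mathrm{Hom}(\wedge^{n-1}V\otimes V,\mathfrak g)$ for $n\ge1$, in degree $n$, regarded as a subspace of $\mathrm{Hom}(\wedge^{n-1}W\otimes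 W,W)$ for $W=\mathfrak g\oplus V$ (extension by zero). Let $\theta,\widehat H:W\otimes W\to W$ be $\theta\big((x,u),(y,v)\big)=(x\cdot y,\ \mathcal L_xv+\mathcal R_yu)$ and $\widehat H\big((x,u),(y,v)\big)=(0,H(x,y))$. For $P\in C^p$, $Q\in C^q$, $R\in C^r$ define $$\llbracket P,Q\rrbracket=(-1)^{p-1}\big[[\theta,P]^{MN},Q\big]^{MN}\in C^{p+q},\qquad \llbracket P,Q,R\rrbracket=(-1)^{q-1}\big[[[\widehat H,P]^{MN},Q]^{MN},R\big]^{MN}\in C^{p+q+r-1}.$$ Let $K:V\to\mathfrak g$ be an RCW Reynolds operator. The $L_\infty$-algebra twisted by $K$ is $\bigoplus_{n\ge1}C^n$ with the structure maps $$l_1(P)=d_K(P)=\llbracket K,P\rrbracket+\tfrac12\llbracket K,K,P\rrbracket,\qquad l_2(P,Q)=\llbracket P,Q\rrbracket+\llbracket K,P,Q\rrbracket,\qquad l_3(P,Q,R)=\llbracket P,Q,R\rrbracket,$$ and $l_k=0$ for $k\ge4$. An element $\alpha\in C^1=\mathrm{Hom}(V,\mathfrak g)$ is a Maurer–Cartan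 element of it if $$l_1(\alpha)+\tfrac1{2!}\,l_2(\alpha,\alpha)+\tfrac1{3!}\,l_3(\alpha,\alpha,\alpha)=0 .$$ **Theorem.** For every linear map $K':V\to\mathfrak g$, the sum $K+K'$ is an RCW Reynolds operator if and only if $K'$ is a Maurer–Cartan element of the $L_\infty$-algebra twisted by $K$. -/

import Mathlib

/-- A representation `(V; L, R)` of a (left) pre-Lie algebra `g`. -/
structure PreLieRep (g V : Type*) [LeftPreLieRing g] [LeftPreLieAlgebra ℂ g]
    [AddCommGroup V] [Module ℂ V] where
  /-- the left action `x ↦ L_x` -/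
  L : g →ₗ[ℂ] V →ₗ[ℂ] V
  /-- the right action `x ↦ R_x` -/
  R : g →ₗ[ℂ] V →ₗ[ℂ] V
  left_left : ∀ (x y : g) (u : V),
    L x (L y u) - L (x * y) u = L y (L x u) - L (y * x) u
  left_right : ∀ (x y : g) (u : V),
    L x (R y u) - R y (L x u) = R (x * y) u - R y (R x u)

/-- `H : g ⊗ g → V` is a 2-cocycle of the pre-Lie algebra `g` with coefficients in `V`. -/
def IsTwoCocycle {g V : Type*} [LeftPreLieRing g] [LeftPreLieAlgebra ℂ g]
    [AddCommGroup V] [Module ℂ V] (ρ : PreLieRep g V) (H : g →ₗ[ℂ] g →ₗ[ℂ] V) : Prop :=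
  ∀ x y z : g,
    ρ.L x (H y z) - ρ.L y (H x z) + ρ.R z (H y x) - ρ.R z (H x y)
      - H y (x * z) + H x (y * z) - H (x * y - y * x) z = 0

/-- `K : V → g` is a relative cocycle weighted (RCW) Reynolds operator with weight `H`. -/
def IsRCWReynolds {g V : Type*} [LeftPreLieRing g] [LeftPreLieAlgebra ℂ g]
    [AddCommGroup V] [Module ℂ V] (ρ : PreLieRep g V) (H : g →ₗ[ℂ] g →ₗ[ℂ] V)
    (K : V →ₗ[ℂ] g) : Prop :=
  ∀ u v : V, K u * K v = K (ρ.L (K u) v + ρ.R (K v) u + H (K u) (K v))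

/-- `PLCochain M N n` is `Hom(∧ⁿM ⊗ M, N)`: maps in `n + 1` arguments, alternating in the first
`n` ones.  `P x y` is the value at `x₁ ∧ ⋯ ∧ xₙ ⊗ y`. -/
abbrev PLCochain (M N : Type*) [AddCommGroup M] [Module ℂ M] [AddCommGroup N] [Module ℂ N]
    (n : ℕ) : Type _ :=
  M [⋀^Fin n]→ₗ[ℂ] (M →ₗ[ℂ] N)

namespace PLCochain

section General

variable {M N : Type*} [AddCommGroup M] [Module ℂ M] [AddCommGroup N] [Module ℂ N]

/-- Transport along an equality of degrees. -/
def cast {m n : ℕ} (h : m = n) (P : PLCochain M N m) : PLCochain M N n :=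
  AlternatingMap.domDomCongr (finCongr h) P

/-- The antisymmetrisation of `Q ∈ Hom(∧^q M ⊗ M, M)` over all of its `q + 1` arguments:
`(x₁, …, x_{q+1}) ↦ ∑_σ sgn(σ) Q(x_{σ(1)}, …, x_{σ(q)}, x_{σ(q+1)})`
over the `(q, 1)`-unshuffles `σ`. (`AlternatingMap.domCoprod` is the sum over unshuffles.) -/
noncomputable def hat {q : ℕ} (Q : PLCochain M M q) : M [⋀^Fin q ⊕ Fin 1]→ₗ[ℂ] M :=
  (TensorProduct.lift (LinearMap.id : (M →ₗ[ℂ] M) →ₗ[ℂ] (M →ₗ[ℂ] M))).compAlternatingMap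
    (AlternatingMap.domCoprod Q (AlternatingMap.ofSubsingleton ℂ M M (0 : Fin 1) LinearMap.id))

/-- `P ∈ Hom(∧^{p+1} M ⊗ M, N)` regarded as the alternating map sending `x₁, …, x_p` to
`w ↦ y ↦ P(w, x₁, …, x_p, y)`. -/
def splitFirst {p : ℕ} (P : PLCochain M N (p + 1)) :
    M [⋀^Fin p]→ₗ[ℂ] (M →ₗ[ℂ] M →ₗ[ℂ] N) where
  toFun x :=
    { toFun := fun w => P.curryLeft w x
      map_add' := fun a b => by rw [map_add]; rfl
      map_smul' := fun c a => by rw [map_smul]; rfl }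
  map_update_add' x i a b := LinearMap.ext fun w => (P.curryLeft w).map_update_add x i a b
  map_update_smul' x i c a := LinearMap.ext fun w => (P.curryLeft w).map_update_smul x i c a
  map_eq_zero_of_eq' x _ _ hx hij :=
    LinearMap.ext fun w => (P.curryLeft w).map_eq_zero_of_eq x hx hij

theorem splitFirst_apply {p : ℕ} (P : PLCochain M N (p + 1)) (x : Fin p → M) (w y : M) :
    splitFirst P x w y = P (Fin.cons w x) y := rfl

/-- The sum over the `(q, 1, p-1)`-unshuffles `σ` of
`sgn(σ) P(Q(x_{σ(1)}, …, x_{σ(q)}, x_{σ(q+1)}), x_{σ(q+2)}, …, x_{σ(p+q)}, y)`; it is empty for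
`p = 0`. -/
noncomputable def insertFirst : {p q : ℕ} → PLCochain M M p → PLCochain M M q →
    PLCochain M M (p + q)
  | 0, _, _, _ => 0
  | p + 1, q, P, Q =>
    AlternatingMap.domDomCongr
      (((Equiv.sumCongr finSumFinEquiv (Equiv.refl (Fin p))).trans finSumFinEquiv).trans
        (finCongr (by omega)))
      ((TensorProduct.lift (LinearMap.id : (M →ₗ[ℂ] M →ₗ[ℂ] M) →ₗ[ℂ] _).flip).compAlternatingMap
        (AlternatingMap.domCoprod (hat Q) (splitFirst P)))

/-- The sum over the `(p, q)`-unshuffles `σ` of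
`sgn(σ) P(x_{σ(1)}, …, x_{σ(p)}, Q(x_{σ(p+1)}, …, x_{σ(p+q)}, y))`. -/
noncomputable def insertLast {p q : ℕ} (P : PLCochain M M p) (Q : PLCochain M M q) :
    PLCochain M M (p + q) :=
  AlternatingMap.domDomCongr finSumFinEquiv
    ((LinearMap.mul' ℂ (Module.End ℂ M)).compAlternatingMap (AlternatingMap.domCoprod P Q))

/-- The product `P ⋄ Q`. -/
noncomputable def diamond {p q : ℕ} (P : PLCochain M M p) (Q : PLCochain M M q) :
    PLCochain M M (p + q) :=
  insertFirst P Q + (-1 : ℂ) ^ (p * q) • insertLast P Q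

/-- The Matsushima-Nijenhuis bracket `[P, Q] = P ⋄ Q - (-1)^{pq} Q ⋄ P`. -/
noncomputable def mnBracket {p q : ℕ} (P : PLCochain M M p) (Q : PLCochain M M q) :
    PLCochain M M (p + q) :=
  diamond P Q - (-1 : ℂ) ^ (p * q) • cast (Nat.add_comm q p) (diamond Q P)

/-- A bilinear map `M ⊗ M → N` as an element of `Hom(∧¹M ⊗ M, N)`. -/
def ofBilin (B : M →ₗ[ℂ] M →ₗ[ℂ] N) : PLCochain M N 1 :=
  AlternatingMap.ofSubsingleton ℂ M (M →ₗ[ℂ] N) (0 : Fin 1) B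

/-- A linear map `M → N` as an element of `Hom(∧⁰M ⊗ M, N)`. -/
def ofLinear (K : M →ₗ[ℂ] N) : PLCochain M N 0 :=
  AlternatingMap.constOfIsEmpty ℂ M (Fin 0) K

end General

section Brackets

variable {g V : Type*} [LeftPreLieRing g] [LeftPreLieAlgebra ℂ g]
  [AddCommGroup V] [Module ℂ V]

/-- The inclusion of `Hom(∧ⁿV ⊗ V, g)` in `Hom(∧ⁿ(g ⊕ V) ⊗ (g ⊕ V), g ⊕ V)`: extension by zero. -/
def lift {n : ℕ} (P : PLCochain V g n) : PLCochain (g × V) (g × V) n :=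
  (LinearMap.compAlternatingMap
    ((LinearMap.lcomp ℂ (g × V) (LinearMap.snd ℂ g V)).comp
      (LinearMap.llcomp ℂ V g (g × V) (LinearMap.inl ℂ g V))) P).compLinearMap
    (LinearMap.snd ℂ g V)

/-- The component in `Hom(∧ⁿV ⊗ V, g)` of an element of
`Hom(∧ⁿ(g ⊕ V) ⊗ (g ⊕ V), g ⊕ V)`. -/
def restrict {n : ℕ} (P : PLCochain (g × V) (g × V) n) : PLCochain V g n :=
  (LinearMap.compAlternatingMap
    ((LinearMap.lcomp ℂ g (LinearMap.inr ℂ g V)).comp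
      (LinearMap.llcomp ℂ (g × V) (g × V) g (LinearMap.fst ℂ g V))) P).compLinearMap
    (LinearMap.inr ℂ g V)

theorem lift_apply {n : ℕ} (P : PLCochain V g n) (x : Fin n → g × V) (y : g × V) :
    lift P x y = (P (fun i => (x i).2) y.2, 0) := rfl

theorem restrict_apply {n : ℕ} (P : PLCochain (g × V) (g × V) n) (x : Fin n → V) (y : V) :
    restrict P x y = (P (fun i => (0, x i)) (0, y)).1 := rfl

/-- `π + L + R`: the product `(x, u)(y, v) = (x y, L_x v + R_y u)` on `g ⊕ V`. -/
noncomputable def semidirect (ρ : PreLieRep g V) : PLCochain (g × V) (g × V) 1 :=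
  ofBilin (LinearMap.mk₂ ℂ
    (fun a b : g × V => (a.1 * b.1, ρ.L a.1 b.2 + ρ.R b.1 a.2))
    (fun a b c => by ext <;> simp [add_mul, add_add_add_comm])
    (fun c a b => by ext <;> simp [smul_mul_assoc])
    (fun a b c => by ext <;> simp [mul_add, add_add_add_comm])
    (fun c a b => by ext <;> simp [mul_smul_comm]))

/-- `H` as the bilinear map `((x, u), (y, v)) ↦ (0, H(x, y))` on `g ⊕ V`. -/
noncomputable def weight (H : g →ₗ[ℂ] g →ₗ[ℂ] V) : PLCochain (g × V) (g × V) 1 :=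
  ofBilin (LinearMap.mk₂ ℂ (fun a b : g × V => ((0 : g), H a.1 b.1))
    (fun a b c => by ext <;> simp)
    (fun c a b => by ext <;> simp)
    (fun a b c => by ext <;> simp)
    (fun c a b => by ext <;> simp))

/-- The binary bracket `⟦P, Q⟧ = (-1)^p [[π + L + R, P], Q]` for `P ∈ Hom(∧^p V ⊗ V, g)` and
`Q ∈ Hom(∧^q V ⊗ V, g)`. -/
noncomputable def binary (ρ : PreLieRep g V) {p q : ℕ} (P : PLCochain V g p)
    (Q : PLCochain V g q) : PLCochain V g (p + q + 1) :=
  (-1 : ℂ) ^ p •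
    cast (by omega) (restrict (mnBracket (mnBracket (semidirect ρ) (lift P)) (lift Q)))

/-- The ternary bracket `⟦P, Q, R⟧ = (-1)^q [[[H, P], Q], R]` for `P ∈ Hom(∧^p V ⊗ V, g)`,
`Q ∈ Hom(∧^q V ⊗ V, g)` and `R ∈ Hom(∧^r V ⊗ V, g)`. -/
noncomputable def ternary (H : g →ₗ[ℂ] g →ₗ[ℂ] V) {p q r : ℕ} (P : PLCochain V g p)
    (Q : PLCochain V g q) (R : PLCochain V g r) : PLCochain V g (p + q + r + 1) :=
  (-1 : ℂ) ^ q •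
    cast (by omega)
      (restrict (mnBracket (mnBracket (mnBracket (weight H) (lift P)) (lift Q)) (lift R)))

/-- `l₁` of the structure twisted by `K`: `d_K(P) = ⟦K, P⟧ + ½ ⟦K, K, P⟧`. -/
noncomputable def twistedUnary (ρ : PreLieRep g V) (H : g →ₗ[ℂ] g →ₗ[ℂ] V) (K : V →ₗ[ℂ] g)
    {p : ℕ} (P : PLCochain V g p) : PLCochain V g (p + 1) :=
  cast (by omega) (binary ρ (ofLinear K) P) +
    (1 / 2 : ℂ) • cast (by omega) (ternary H (ofLinear K) (ofLinear K) P)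

/-- `l₂` of the structure twisted by `K`: `⟦P, Q⟧_K = ⟦P, Q⟧ + ⟦K, P, Q⟧`. -/
noncomputable def twistedBinary (ρ : PreLieRep g V) (H : g →ₗ[ℂ] g →ₗ[ℂ] V) (K : V →ₗ[ℂ] g)
    {p q : ℕ} (P : PLCochain V g p) (Q : PLCochain V g q) : PLCochain V g (p + q + 1) :=
  binary ρ P Q + cast (by omega) (ternary H (ofLinear K) P Q)

/-- `l₃` of the structure twisted by `K`: `⟦P, Q, R⟧_K = ⟦P, Q, R⟧`. The brackets `l_k` with
`k ≥ 4` vanish. -/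
noncomputable def twistedTernary (H : g →ₗ[ℂ] g →ₗ[ℂ] V) {p q r : ℕ} (P : PLCochain V g p)
    (Q : PLCochain V g q) (R : PLCochain V g r) : PLCochain V g (p + q + r + 1) :=
  ternary H P Q R

/-- `α` is a Maurer-Cartan element of the `L∞`-algebra twisted by `K`. The summand
`Hom(∧ⁿV ⊗ V, g)` has `L∞`-degree `n + 1`, so elements of degree `1` are elements of
`Hom(∧⁰V ⊗ V, g)`; the equation is `l₁(α) + l₂(α, α) / 2! + l₃(α, α, α) / 3! = 0`. -/
def IsTwistedMaurerCartan (ρ : PreLieRep g V) (H : g →ₗ[ℂ] g →ₗ[ℂ] V) (K : V →ₗ[ℂ] g)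
    (α : PLCochain V g 0) : Prop :=
  twistedUnary ρ H K α + (1 / 2 : ℂ) • twistedBinary ρ H K α α +
    (1 / 6 : ℂ) • twistedTernary H α α α = 0

end Brackets

end PLCochain

/-!
The Reynolds equation is itself a Maurer-Cartan equation: with
`MC(T) = ⟦T, T⟧ / 2! + ⟦T, T, T⟧ / 3!`, a linear map `T : V → g` is an RCW Reynolds operator if and
only if `MC(T) = 0`. On linear maps the binary and ternary brackets are symmetric and multilinear,
so expanding `MC(K + S)` gives `MC(K)` plus exactly the Maurer-Cartan expression of `S` in the
structure twisted by `K`.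
-/

section DomCoprod

variable {ιa ιb : Type*}

theorem subsingleton_modSumCongr_of_isEmpty_right [IsEmpty ιb] :
    Subsingleton (Equiv.Perm.ModSumCongr ιa ιb) := by
  refine QuotientGroup.subsingleton_iff.mpr (eq_top_iff.mpr fun σ _ => ?_)
  refine ⟨((Equiv.sumEmpty ιa ιb).permCongr σ, 1), Equiv.ext fun i => ?_⟩
  rcases i with a | b
  · rcases h : σ (Sum.inl a) with a' | b'
    · simp [h]
    · exact isEmptyElim b'
  · exact isEmptyElim b

theorem subsingleton_modSumCongr_of_isEmpty_left [IsEmpty ιa] :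
    Subsingleton (Equiv.Perm.ModSumCongr ιa ιb) := by
  refine QuotientGroup.subsingleton_iff.mpr (eq_top_iff.mpr fun σ _ => ?_)
  refine ⟨(1, (Equiv.emptySum ιa ιb).permCongr σ), Equiv.ext fun i => ?_⟩
  rcases i with a | b
  · exact isEmptyElim a
  · rcases h : σ (Sum.inr b) with a' | b'
    · exact isEmptyElim a'
    · simp [h]

variable {R M N₁ N₂ : Type*} [CommRing R] [AddCommGroup M] [Module R M] [AddCommGroup N₁]
  [Module R N₁] [AddCommGroup N₂] [Module R N₂] [Fintype ιa] [Fintype ιb] [DecidableEq ιa]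
  [DecidableEq ιb]

theorem domCoprod_apply_of_subsingleton [Subsingleton (Equiv.Perm.ModSumCongr ιa ιb)]
    (a : M [⋀^ιa]→ₗ[R] N₁) (b : M [⋀^ιb]→ₗ[R] N₂) (v : ιa ⊕ ιb → M) :
    a.domCoprod b v = a (fun i => v (Sum.inl i)) ⊗ₜ[R] b (fun i => v (Sum.inr i)) := by
  rw [AlternatingMap.domCoprod_apply, sum_apply]
  refine (Fintype.sum_subsingleton _ (Quotient.mk'' 1)).trans ?_
  rw [AlternatingMap.domCoprod.summand_mk'']
  simp

end DomCoprod

namespace PLCochain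

section General

variable {M : Type*} [AddCommGroup M] [Module ℂ M] {p : ℕ}

theorem insertLast_ofLinear_apply (P : PLCochain M M p) (T : M →ₗ[ℂ] M) (x : Fin p → M) (y : M) :
    insertLast P (ofLinear T) x y = P x (T y) := by
  have := subsingleton_modSumCongr_of_isEmpty_right (ιa := Fin p) (ιb := Fin 0)
  simp only [insertLast, AlternatingMap.domDomCongr_apply, LinearMap.compAlternatingMap_apply,
    domCoprod_apply_of_subsingleton]
  rfl

theorem ofLinear_insertLast_apply (T : M →ₗ[ℂ] M) (P : PLCochain M M p) (x : Fin (0 + p) → M)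
    (y : M) : insertLast (ofLinear T) P x y = T (P (fun i => x (Fin.natAdd 0 i)) y) := by
  have := subsingleton_modSumCongr_of_isEmpty_left (ιa := Fin 0) (ιb := Fin p)
  simp only [insertLast, AlternatingMap.domDomCongr_apply, LinearMap.compAlternatingMap_apply,
    domCoprod_apply_of_subsingleton]
  rfl

theorem hat_ofLinear_apply (T : M →ₗ[ℂ] M) (x : Fin 0 ⊕ Fin 1 → M) :
    hat (ofLinear T) x = T (x (Sum.inr 0)) := by
  have := subsingleton_modSumCongr_of_isEmpty_left (ιa := Fin 0) (ιb := Fin 1)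
  simp only [hat, LinearMap.compAlternatingMap_apply, domCoprod_apply_of_subsingleton]
  rfl

theorem insertFirst_ofLinear_apply (P : PLCochain M M 1) (T : M →ₗ[ℂ] M) (x : Fin 1 → M) (y : M) :
    insertFirst P (ofLinear T) x y = P ![T (x 0)] y := by
  have := subsingleton_modSumCongr_of_isEmpty_right (ιa := Fin 0 ⊕ Fin 1) (ιb := Fin 0)
  simp only [insertFirst, AlternatingMap.domDomCongr_apply, LinearMap.compAlternatingMap_apply,
    domCoprod_apply_of_subsingleton, hat_ofLinear_apply]
  exact congrArg (fun z => P (Matrix.vecCons (T (x 0)) z) y) (Subsingleton.elim _ _)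

theorem diamond_ofLinear_apply (P : PLCochain M M 1) (T : M →ₗ[ℂ] M) (x : Fin 1 → M) (y : M) :
    diamond P (ofLinear T) x y = P ![T (x 0)] y + P x (T y) := by
  rw [← insertFirst_ofLinear_apply, ← insertLast_ofLinear_apply]
  simp [diamond]

theorem ofLinear_diamond_apply (T : M →ₗ[ℂ] M) (P : PLCochain M M p) (x : Fin (0 + p) → M)
    (y : M) : diamond (ofLinear T) P x y = T (P (fun i => x (Fin.natAdd 0 i)) y) := by
  rw [← ofLinear_insertLast_apply]
  simp [diamond, insertFirst]

theorem mnBracket_ofLinear_apply (P : PLCochain M M 1) (T : M →ₗ[ℂ] M) (x : Fin 1 → M) (y : M) :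
    mnBracket P (ofLinear T) x y = P ![T (x 0)] y + P x (T y) - T (P x y) := by
  have h_cast : cast (Nat.add_comm 0 1) (diamond (ofLinear T) P) x y = T (P x y) :=
    (ofLinear_diamond_apply T P _ y).trans
      (congrArg (fun z => T (P z y)) (funext fun i => congrArg x (Subsingleton.elim _ _)))
  rw [← diamond_ofLinear_apply, ← h_cast]
  simp [mnBracket]

end General

section Brackets

variable {g V : Type*} [LeftPreLieRing g] [LeftPreLieAlgebra ℂ g]
  [AddCommGroup V] [Module ℂ V]

theorem lift_ofLinear (K : V →ₗ[ℂ] g) :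
    lift (ofLinear K) = ofLinear (LinearMap.inl ℂ g V ∘ₗ K ∘ₗ LinearMap.snd ℂ g V) := rfl

theorem semidirect_apply (ρ : PreLieRep g V) (x : Fin 1 → g × V) (y : g × V) :
    semidirect ρ x y = ((x 0).1 * y.1, ρ.L (x 0).1 y.2 + ρ.R y.1 (x 0).2) := rfl

theorem weight_apply (H : g →ₗ[ℂ] g →ₗ[ℂ] V) (x : Fin 1 → g × V) (y : g × V) :
    weight H x y = (0, H (x 0).1 y.1) := rfl

theorem binary_ofLinear_apply (ρ : PreLieRep g V) (S T : V →ₗ[ℂ] g) (x : Fin 1 → V) (v : V) :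
    binary ρ (ofLinear S) (ofLinear T) x v =
      S (x 0) * T v + T (x 0) * S v - S (ρ.L (T (x 0)) v + ρ.R (T v) (x 0))
        - T (ρ.L (S (x 0)) v + ρ.R (S v) (x 0)) := by
  have h_restrict : binary ρ (ofLinear S) (ofLinear T) x v =
      (mnBracket (p := 1) (mnBracket (semidirect ρ) (lift (ofLinear S))) (lift (ofLinear T))
        (fun i => (0, x i)) (0, v)).1 := by
    rw [binary, pow_zero, one_smul]
    rfl
  rw [h_restrict]
  simp only [lift_ofLinear, mnBracket_ofLinear_apply, semidirect_apply, LinearMap.coe_comp,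
    LinearMap.coe_inl, LinearMap.coe_snd, Function.comp_apply, Matrix.cons_val_fin_one,
    Prod.mk_add_mk, Prod.mk_sub_mk, map_add, map_zero, LinearMap.zero_apply, zero_mul, mul_zero,
    add_zero, zero_add, sub_zero]
  abel

theorem ternary_ofLinear_apply (H : g →ₗ[ℂ] g →ₗ[ℂ] V) (S T U : V →ₗ[ℂ] g) (x : Fin 1 → V)
    (v : V) :
    ternary H (ofLinear S) (ofLinear T) (ofLinear U) x v =
      -(S (H (T (x 0)) (U v)) + S (H (U (x 0)) (T v)) + T (H (S (x 0)) (U v))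
        + T (H (U (x 0)) (S v)) + U (H (S (x 0)) (T v)) + U (H (T (x 0)) (S v))) := by
  have h_restrict : ternary H (ofLinear S) (ofLinear T) (ofLinear U) x v =
      (mnBracket (p := 1) (mnBracket (p := 1) (mnBracket (weight H) (lift (ofLinear S)))
        (lift (ofLinear T))) (lift (ofLinear U)) (fun i => (0, x i)) (0, v)).1 := by
    rw [ternary, pow_zero, one_smul]
    rfl
  rw [h_restrict]
  simp only [lift_ofLinear, mnBracket_ofLinear_apply, weight_apply, LinearMap.coe_comp,
    LinearMap.coe_inl, LinearMap.coe_snd, Function.comp_apply, Matrix.cons_val_fin_one,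
    Prod.mk_add_mk, Prod.mk_sub_mk, map_add, map_zero, LinearMap.zero_apply, add_zero, zero_add,
    sub_zero, zero_sub, sub_self]
  abel

theorem binary_ofLinear_add_self (ρ : PreLieRep g V) (S T : V →ₗ[ℂ] g) :
    binary ρ (ofLinear (S + T)) (ofLinear (S + T)) =
      binary ρ (ofLinear S) (ofLinear S) + (2 : ℂ) • binary ρ (ofLinear S) (ofLinear T)
        + binary ρ (ofLinear T) (ofLinear T) := by
  ext x v
  simp only [AlternatingMap.add_apply, AlternatingMap.smul_apply, LinearMap.add_apply,
    LinearMap.smul_apply, binary_ofLinear_apply, map_add, mul_add, add_mul]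
  module

theorem ternary_ofLinear_add_self (H : g →ₗ[ℂ] g →ₗ[ℂ] V) (S T : V →ₗ[ℂ] g) :
    ternary H (ofLinear (S + T)) (ofLinear (S + T)) (ofLinear (S + T)) =
      ternary H (ofLinear S) (ofLinear S) (ofLinear S)
        + (3 : ℂ) • ternary H (ofLinear S) (ofLinear S) (ofLinear T)
        + (3 : ℂ) • ternary H (ofLinear S) (ofLinear T) (ofLinear T)
        + ternary H (ofLinear T) (ofLinear T) (ofLinear T) := by
  ext x v
  simp only [AlternatingMap.add_apply, AlternatingMap.smul_apply, LinearMap.add_apply,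
    LinearMap.smul_apply, ternary_ofLinear_apply, map_add]
  module

/-- The left-hand side `⟦α, α⟧ / 2! + ⟦α, α, α⟧ / 3!` of the Maurer-Cartan equation in the untwisted
algebra, for `α` of degree `1`, that is, `α ∈ Hom(∧⁰V ⊗ V, g)`. -/
noncomputable def maurerCartan (ρ : PreLieRep g V) (H : g →ₗ[ℂ] g →ₗ[ℂ] V)
    (α : PLCochain V g 0) : PLCochain V g 1 :=
  (1 / 2 : ℂ) • binary ρ α α + (1 / 6 : ℂ) • ternary H α α α

/-- The left-hand side `l₁(α) + l₂(α, α) / 2! + l₃(α, α, α) / 3!` of the Maurer-Cartan equation in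
the algebra twisted by `K`, for `α` of degree `1`. -/
noncomputable def twistedMaurerCartan (ρ : PreLieRep g V) (H : g →ₗ[ℂ] g →ₗ[ℂ] V) (K : V →ₗ[ℂ] g)
    (α : PLCochain V g 0) : PLCochain V g 1 :=
  twistedUnary ρ H K α + (1 / 2 : ℂ) • twistedBinary ρ H K α α +
    (1 / 6 : ℂ) • twistedTernary H α α α

theorem maurerCartan_ofLinear_apply (ρ : PreLieRep g V) (H : g →ₗ[ℂ] g →ₗ[ℂ] V) (T : V →ₗ[ℂ] g)
    (x : Fin 1 → V) (v : V) :
    maurerCartan ρ H (ofLinear T) x v =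
      T (x 0) * T v - T (ρ.L (T (x 0)) v + ρ.R (T v) (x 0) + H (T (x 0)) (T v)) := by
  simp only [maurerCartan, AlternatingMap.add_apply, AlternatingMap.smul_apply,
    LinearMap.add_apply, LinearMap.smul_apply, binary_ofLinear_apply, ternary_ofLinear_apply,
    map_add]
  module

theorem maurerCartan_ofLinear_eq_zero_iff (ρ : PreLieRep g V) (H : g →ₗ[ℂ] g →ₗ[ℂ] V)
    (T : V →ₗ[ℂ] g) : maurerCartan ρ H (ofLinear T) = 0 ↔ IsRCWReynolds ρ H T := by
  constructor
  · intro h u v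
    refine sub_eq_zero.mp ((maurerCartan_ofLinear_apply ρ H T ![u] v).symm.trans ?_)
    rw [h]
    rfl
  · intro h
    ext x v
    rw [maurerCartan_ofLinear_apply, h (x 0) v, sub_self]
    rfl

theorem maurerCartan_ofLinear_add (ρ : PreLieRep g V) (H : g →ₗ[ℂ] g →ₗ[ℂ] V) (S T : V →ₗ[ℂ] g) :
    maurerCartan ρ H (ofLinear (S + T)) =
      maurerCartan ρ H (ofLinear S) + twistedMaurerCartan ρ H S (ofLinear T) := by
  have h_twisted : twistedMaurerCartan ρ H S (ofLinear T) =
      binary ρ (ofLinear S) (ofLinear T)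
        + (1 / 2 : ℂ) • ternary H (ofLinear S) (ofLinear S) (ofLinear T)
        + (1 / 2 : ℂ) • (binary ρ (ofLinear T) (ofLinear T)
          + ternary H (ofLinear S) (ofLinear T) (ofLinear T))
        + (1 / 6 : ℂ) • ternary H (ofLinear T) (ofLinear T) (ofLinear T) := rfl
  rw [h_twisted, maurerCartan, maurerCartan, binary_ofLinear_add_self, ternary_ofLinear_add_self]
  module

end Brackets

end PLCochain

theorem mainTheorem2_general {g V : Type*} [LeftPreLieRing g] [LeftPreLieAlgebra ℂ g]
    [AddCommGroup V] [Module ℂ V] (ρ : PreLieRep g V) (H : g →ₗ[ℂ] g →ₗ[ℂ] V)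
    (K : V →ₗ[ℂ] g) (hK : IsRCWReynolds ρ H K) (K' : V →ₗ[ℂ] g) :
    IsRCWReynolds ρ H (K + K') ↔
      PLCochain.IsTwistedMaurerCartan ρ H K (PLCochain.ofLinear K') := by
  rw [← PLCochain.maurerCartan_ofLinear_eq_zero_iff, PLCochain.maurerCartan_ofLinear_add,
    (PLCochain.maurerCartan_ofLinear_eq_zero_iff ρ H K).mpr hK, zero_add,
    PLCochain.twistedMaurerCartan, PLCochain.IsTwistedMaurerCartan]

theorem mainTheorem2 {g V : Type*} [LeftPreLieRing g] [LeftPreLieAlgebra ℂ g]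
    [AddCommGroup V] [Module ℂ V] (ρ : PreLieRep g V) (H : g →ₗ[ℂ] g →ₗ[ℂ] V)
    (hH : IsTwoCocycle ρ H) (K : V →ₗ[ℂ] g) (hK : IsRCWReynolds ρ H K)
    (K' : V →ₗ[ℂ] g) :
    IsRCWReynolds ρ H (K + K') ↔
      PLCochain.IsTwistedMaurerCartan ρ H K (PLCochain.ofLinear K') :=
  mainTheorem2_general ρ H K hK K'
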